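/- Let $\mathscr B$ be a monoidal bicategory: a bicategory with a tensor pseudofunctor $\otimes\colon\mathscr B\times\mathscr B\to\mathscr B$, a unit object $I$, pseudonatural adjoint equivalences $a_{A,B,C}\colon (A\otimes B)\otimes C\to A\otimes(B\otimes C)$, $l_A\colon I\otimes A\to A$, $r_A\colon A\otimes I\to A$ (with adjoint inverses $a^\bullet,l^\bullet,r^\bullet$), and invertible modifications (the 2-associator and the left, middle and right 2-unitors, the middle one being $\mu_{A,B}\colon (A\otimes l_B)\circ a_{A,I,B}\cong r_A\otimes B$) satisfying the associahedron axiom and the two unit axioms. Objects also denote their identity 1-cells. For 1-cells $f\colon A_0\to A_1$, $g\colon B_0\to B_1$ the interchangerator is the invertible 2-cell $$\chi_{f,g}\colon (A_1\otimes g)\circ(f\otimes B_0)\cong (A_1\circ f)\otimes(g\circ B_0)\cong (f\circ A_0)\otimes(B_1\circ g)\cong (f\otimes B_1)\circ(A_0\otimes g)$$ given by the compositor of $\otimes$, unitors, and the inverse compositor. Let $\theta\colon l_I\Rightarrow r_I$ be the invertible 2-cell $$l_I\;\cong\; r_I\circ l_{I\otimes I}\circ a_{I,I,I}\circ r^\bullet_{I\otimes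 I}\;\cong\; r_I\circ(I\otimes l_I)\circ a_{I,I,I}\circ(r^\bullet_I\otimes I)\;\cong\; r_I\circ (r_I\otimes I)\circ (r_I^\bullet\otimes I)\;\cong\; r_I,$$ where the first isomorphism uses $r\circ r^\bullet\cong 1$, naturality of $r$ at $l_I$, and the left 2-unitor; the second uses $l_{I\otimes I}\cong I\otimes l_I$ and $r^\bullet_{I\otimes I}\cong r^\bullet_I\otimes I$, obtained from naturality of $l$ at $l_I$ and of $r^\bullet$ at $r^\bullet_I$ by cancelling equivalences; the third is the middle 2-unitor; the last is $r_I\circ r^\bullet_I\cong 1$. For scalars $f,g\colon I\to I$ let $\mathbb X_{f,g}\colon g\circ f\Rightarrow f\circ g$ be the composite $$g f\cong g f r_I r_I^\bullet\cong g\, r_I (f\otimes I) r_I^\bullet\overset{\theta^{-1}}{\cong} g\, l_I (f\otimes I) r_I^\bullet\cong l_I (I\otimes g)(f\otimes I) r_I^\bullet\overset{\chi_{f,g}}{\cong} l_I (f\otimes I)(I\otimes g) r_I^\bullet$$ $$\overset{\theta}{\cong} r_I (f\otimes I)(I\otimes g) r_I^\bullet\cong f r_I (I\otimes g) r_I^\bullet\overset{\theta^{-1}}{\cong}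 f\, l_I (I\otimes g) r_I^\bullet\cong f g\, l_I r_I^\bullet\overset{\theta}{\cong} f g\, r_I r_I^\bullet\cong f g,$$ whose unlabelled steps are the counit $r_I\circ r_I^\bullet\cong 1_I$ and the naturality constraints of $r$ and $l$. Lemma. The family $(\mathbb X_{f,g})$ is a braiding on the monoidal category of scalars $(\mathscr B(I,I),\circ)$: every $\mathbb X_{f,g}$ is invertible, $\mathbb X_{f,g}$ is natural in $f$ and $g$, and both hexagon identities hold. (With the tensor product "first $f$, then $g$", $\mathbb X_{f,g}$ is the braiding of $f$ with $g$; with the tensor product $f\otimes g=f\circ g$, it is the braiding of $g$ with $f$. The lemma asserts both.) -/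

import Mathlib

open CategoryTheory Bicategory
open scoped Pseudofunctor.StrongTrans

universe w v u w₁ v₁ u₁ w₂ v₂ u₂ w₃ v₃ u₃ w₄ v₄ u₄

namespace CategoryTheory.Pseudofunctor

/-- The product `F × G : A × C ⥤ᵖ B × D` of two pseudofunctors. -/
def prodMap {A : Type u₁} [Bicategory.{w₁, v₁} A] {B : Type u₂} [Bicategory.{w₂, v₂} B]
    {C : Type u₃} [Bicategory.{w₃, v₃} C] {D : Type u₄} [Bicategory.{w₄, v₄} D]
    (F : A ⥤ᵖ B) (G : C ⥤ᵖ D) : (A × C) ⥤ᵖ (B × D) where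
  obj X := (F.obj X.1, G.obj X.2)
  map f := (F.map f.1, G.map f.2)
  map₂ η := (F.map₂ η.1, G.map₂ η.2)
  map₂_id _ := Prod.ext (F.map₂_id _) (G.map₂_id _)
  map₂_comp _ _ := Prod.ext (F.map₂_comp _ _) (G.map₂_comp _ _)
  mapId X := Iso.prod (F.mapId X.1) (G.mapId X.2)
  mapComp f g := Iso.prod (F.mapComp f.1 g.1) (G.mapComp f.2 g.2)
  map₂_whisker_left _ _ _ _ :=
    Prod.ext (F.map₂_whisker_left _ _) (G.map₂_whisker_left _ _)
  map₂_whisker_right _ _ := Prod.ext (F.map₂_whisker_right _ _) (G.map₂_whisker_right _ _)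
  map₂_associator _ _ _ := Prod.ext (F.map₂_associator _ _ _) (G.map₂_associator _ _ _)
  map₂_left_unitor _ := Prod.ext (F.map₂_left_unitor _) (G.map₂_left_unitor _)
  map₂_right_unitor _ := Prod.ext (F.map₂_right_unitor _) (G.map₂_right_unitor _)

/-- The re-bracketing pseudofunctor `(A × B) × C ⥤ᵖ A × (B × C)`. -/
def prodAssoc (A : Type u₁) [Bicategory.{w₁, v₁} A] (B : Type u₂) [Bicategory.{w₂, v₂} B]
    (C : Type u₃) [Bicategory.{w₃, v₃} C] : ((A × B) × C) ⥤ᵖ (A × (B × C)) where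
  obj X := (X.1.1, (X.1.2, X.2))
  map f := (f.1.1, (f.1.2, f.2))
  map₂ η := (η.1.1, (η.1.2, η.2))
  map₂_id _ := rfl
  map₂_comp _ _ := rfl
  mapId X := Iso.refl _
  mapComp f g := Iso.refl _
  map₂_whisker_left f _ _ η := by
    refine Prod.ext ?_ (Prod.ext ?_ ?_) <;> simp
  map₂_whisker_right _ _ := by
    refine Prod.ext ?_ (Prod.ext ?_ ?_) <;> simp
  map₂_associator _ _ _ := by
    refine Prod.ext ?_ (Prod.ext ?_ ?_) <;> simp
  map₂_left_unitor _ := by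
    refine Prod.ext ?_ (Prod.ext ?_ ?_) <;> simp
  map₂_right_unitor _ := by
    refine Prod.ext ?_ (Prod.ext ?_ ?_) <;> simp

end CategoryTheory.Pseudofunctor

namespace CategoryTheory

/-- The data of a tensor product on a bicategory: a pseudofunctor `⊗ : B × B ⥤ᵖ B`, a unit object,
and pseudonatural adjoint equivalences (adjoint equivalences in the bicategory of pseudofunctors,
pseudonatural transformations and modifications)
* `a_{X,Y,Z} : (X ⊗ Y) ⊗ Z ⟶ X ⊗ (Y ⊗ Z)`,
* `l_X : I ⊗ X ⟶ X`,
* `r_X : X ⊗ I ⟶ X`. -/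
class TensorBicategory (B : Type u) [Bicategory.{w, v} B] where
  tensor : (B × B) ⥤ᵖ B
  unit : B
  assocEquiv :
    (tensor.prodMap (Pseudofunctor.id B)).comp tensor ≌
      (Pseudofunctor.prodAssoc B B B).comp (((Pseudofunctor.id B).prodMap tensor).comp tensor)
  leftEquiv :
    (Bicategory.Prod.sectR unit B).toPseudofunctor.comp tensor ≌ Pseudofunctor.id B
  rightEquiv :
    (Bicategory.Prod.sectL B unit).toPseudofunctor.comp tensor ≌ Pseudofunctor.id B

namespace TensorBicategory

/-! ### Squares

An invertible 2-cell `f ≫ n' ≅ n ≫ g` is the shape of the naturality constraint of a pseudonatural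
transformation (with components `n`, `n'`) at a 1-cell. -/

section Squares

variable {B : Type u} [Bicategory.{w, v} B]

/-- The naturality square of the identity transformation. -/
def idSq {X Y : B} (f : X ⟶ Y) : f ≫ 𝟙 Y ≅ 𝟙 X ≫ f := ρ_ f ≪≫ (λ_ f).symm

/-- The naturality square of a composite of two transformations. -/
def compSq {X X' Y Y' Z Z' : B} {f : X ⟶ X'} {g : Y ⟶ Y'} {h : Z ⟶ Z'}
    {n : X ⟶ Y} {n' : X' ⟶ Y'} {m : Y ⟶ Z} {m' : Y' ⟶ Z'}
    (s : f ≫ n' ≅ n ≫ g) (t : g ≫ m' ≅ m ≫ h) : f ≫ (n' ≫ m') ≅ (n ≫ m) ≫ h :=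
  (α_ f n' m').symm ≪≫ whiskerRightIso s m' ≪≫ α_ n g m' ≪≫ whiskerLeftIso n t ≪≫ (α_ n m h).symm

/-- The component at `X` of an invertible modification. -/
def isoApp {C : Type u₁} [Bicategory.{w₁, v₁} C] {F G : B ⥤ᵖ C} {η θ : F ⟶ G} (Γ : η ≅ θ) (X : B) :
    η.app X ≅ θ.app X where
  hom := Γ.hom.as.app X
  inv := Γ.inv.as.app X
  hom_inv_id := congrArg (fun m => m.as.app X) Γ.hom_inv_id
  inv_hom_id := congrArg (fun m => m.as.app X) Γ.inv_hom_id

end Squares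

section Basic

variable {B : Type u} [Bicategory.{w, v} B] [TensorBicategory B]

/-- The unit object. -/
def I (B : Type u) [Bicategory.{w, v} B] [TensorBicategory B] : B := unit

/-- Tensor product of objects. -/
def tObj (X Y : B) : B := tensor.obj (X, Y)

infixr:70 " ⊠ " => tObj

/-- Tensor product of 1-cells. -/
def tHom {X X' Y Y' : B} (f : X ⟶ X') (g : Y ⟶ Y') : (X ⊠ Y) ⟶ (X' ⊠ Y') :=
  tensor.map (X := (X, Y)) (Y := (X', Y')) (f, g)

infixr:81 " ⊠₁ " => tHom

/-- Tensor product of invertible 2-cells. -/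
def tIso {X X' Y Y' : B} {f f' : X ⟶ X'} {g g' : Y ⟶ Y'} (γ : f ≅ f') (δ : g ≅ g') :
    f ⊠₁ g ≅ f' ⊠₁ g' :=
  tensor.map₂Iso (a := (X, Y)) (b := (X', Y')) (f := (f, g)) (g := (f', g')) (Iso.prod γ δ)

/-- The compositor of the pseudofunctor `⊗`. -/
def tComp {X X' X'' Y Y' Y'' : B} (f : X ⟶ X') (f' : X' ⟶ X'') (g : Y ⟶ Y') (g' : Y' ⟶ Y'') :
    (f ≫ f') ⊠₁ (g ≫ g') ≅ (f ⊠₁ g) ≫ (f' ⊠₁ g') :=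
  tensor.mapComp (a := (X, Y)) (b := (X', Y')) (c := (X'', Y'')) (f, g) (f', g')

/-- The identitor of the pseudofunctor `⊗`. -/
def tId (X Y : B) : 𝟙 X ⊠₁ 𝟙 Y ≅ 𝟙 (X ⊠ Y) := tensor.mapId (X, Y)

/-- The compositor of the pseudofunctor `- ⊗ Z`. -/
def rComp {X X' X'' : B} (f : X ⟶ X') (f' : X' ⟶ X'') (Z : B) :
    (f ≫ f') ⊠₁ 𝟙 Z ≅ (f ⊠₁ 𝟙 Z) ≫ (f' ⊠₁ 𝟙 Z) :=
  tIso (Iso.refl _) (λ_ (𝟙 Z)).symm ≪≫ tComp f f' (𝟙 Z) (𝟙 Z)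

/-- The compositor of the pseudofunctor `Z ⊗ -`. -/
def lComp (Z : B) {X X' X'' : B} (f : X ⟶ X') (f' : X' ⟶ X'') :
    𝟙 Z ⊠₁ (f ≫ f') ≅ (𝟙 Z ⊠₁ f) ≫ (𝟙 Z ⊠₁ f') :=
  tIso (λ_ (𝟙 Z)).symm (Iso.refl _) ≪≫ tComp (𝟙 Z) (𝟙 Z) f f'

/-- Tensor product of squares. -/
def tSq {X X' Y Y' W W' Z Z' : B} {f : X ⟶ X'} {g : Y ⟶ Y'} {n : X ⟶ Y} {n' : X' ⟶ Y'}
    {h : W ⟶ W'} {k : Z ⟶ Z'} {m : W ⟶ Z} {m' : W' ⟶ Z'}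
    (s : f ≫ n' ≅ n ≫ g) (t : h ≫ m' ≅ m ≫ k) :
    (f ⊠₁ h) ≫ (n' ⊠₁ m') ≅ (n ⊠₁ m) ≫ (g ⊠₁ k) :=
  (tComp f n' h m').symm ≪≫ tIso s t ≪≫ tComp n g m k

/-! ### The associator and the unitors -/

/-- The associator. -/
def assoc (X Y Z : B) : ((X ⊠ Y) ⊠ Z) ⟶ (X ⊠ (Y ⊠ Z)) :=
  (assocEquiv (B := B)).hom.app ((X, Y), Z)

/-- Naturality constraint of the associator. -/
def aSq {X X' Y Y' Z Z' : B} (f : X ⟶ X') (g : Y ⟶ Y') (h : Z ⟶ Z') :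
    ((f ⊠₁ g) ⊠₁ h) ≫ assoc X' Y' Z' ≅ assoc X Y Z ≫ (f ⊠₁ (g ⊠₁ h)) :=
  (assocEquiv (B := B)).hom.naturality (a := ((X, Y), Z)) (b := ((X', Y'), Z')) ((f, g), h)

/-- The left unitor. -/
def lun (X : B) : (I B ⊠ X) ⟶ X := (leftEquiv (B := B)).hom.app X

/-- Naturality constraint of the left unitor. -/
def lSq {X X' : B} (f : X ⟶ X') : (𝟙 (I B) ⊠₁ f) ≫ lun X' ≅ lun X ≫ f :=
  (leftEquiv (B := B)).hom.naturality f

/-- The chosen adjoint inverse `l•` of the left unitor. -/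
def lInv (X : B) : X ⟶ (I B ⊠ X) := (leftEquiv (B := B)).inv.app X

/-- The unit of the adjoint equivalence `(l, l•)`. -/
def lUnit (X : B) : 𝟙 (I B ⊠ X) ≅ lun X ≫ lInv X := isoApp (leftEquiv (B := B)).unit X

/-- The right unitor. -/
def run (X : B) : (X ⊠ I B) ⟶ X := (rightEquiv (B := B)).hom.app X

/-- Naturality constraint of the right unitor. -/
def rSq {X X' : B} (f : X ⟶ X') : (f ⊠₁ 𝟙 (I B)) ≫ run X' ≅ run X ≫ f :=
  (rightEquiv (B := B)).hom.naturality f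

/-- The chosen adjoint inverse `r•` of the right unitor. -/
def rInv (X : B) : X ⟶ (X ⊠ I B) := (rightEquiv (B := B)).inv.app X

/-- Naturality constraint of `r•`. -/
def rInvSq {X X' : B} (f : X ⟶ X') : f ≫ rInv X' ≅ rInv X ≫ (f ⊠₁ 𝟙 (I B)) :=
  (rightEquiv (B := B)).inv.naturality f

/-- The unit of the adjoint equivalence `(r, r•)`. -/
def rUnit (X : B) : 𝟙 (X ⊠ I B) ≅ run X ≫ rInv X := isoApp (rightEquiv (B := B)).unit X

/-- The counit of the adjoint equivalence `(r, r•)`. -/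
def rCounit (X : B) : rInv X ≫ run X ≅ 𝟙 X := isoApp (rightEquiv (B := B)).counit X

/-- Naturality of the associator in its third variable. -/
def aSqRight (X Y : B) {Z Z' : B} (h : Z ⟶ Z') :
    (𝟙 (X ⊠ Y) ⊠₁ h) ≫ assoc X Y Z' ≅ assoc X Y Z ≫ (𝟙 X ⊠₁ (𝟙 Y ⊠₁ h)) :=
  whiskerRightIso (tIso (tId X Y).symm (Iso.refl h)) _ ≪≫ aSq (𝟙 X) (𝟙 Y) h

/-- Naturality of the associator in its first variable. -/
def aSqLeft {X X' : B} (f : X ⟶ X') (Y Z : B) :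
    ((f ⊠₁ 𝟙 Y) ⊠₁ 𝟙 Z) ≫ assoc X' Y Z ≅ assoc X Y Z ≫ (f ⊠₁ 𝟙 (Y ⊠ Z)) :=
  aSq f (𝟙 Y) (𝟙 Z) ≪≫ whiskerLeftIso _ (tIso (Iso.refl f) (tId Y Z))

/-! ### Tensoring 2-cells between composites with an object -/

section Whisker

variable {X₀ X₁ X₁' X₂ X₃ : B}

/-- `γ ⊗ Z` for `γ : f ≫ g ≅ h`. -/
def rMap {f : X₀ ⟶ X₁} {g : X₁ ⟶ X₂} {h : X₀ ⟶ X₂} (γ : f ≫ g ≅ h) (Z : B) :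
    (f ⊠₁ 𝟙 Z) ≫ (g ⊠₁ 𝟙 Z) ≅ h ⊠₁ 𝟙 Z :=
  (rComp f g Z).symm ≪≫ tIso γ (Iso.refl (𝟙 Z))

/-- `Z ⊗ γ` for `γ : f ≫ g ≅ h`. -/
def lMap (Z : B) {f : X₀ ⟶ X₁} {g : X₁ ⟶ X₂} {h : X₀ ⟶ X₂} (γ : f ≫ g ≅ h) :
    (𝟙 Z ⊠₁ f) ≫ (𝟙 Z ⊠₁ g) ≅ 𝟙 Z ⊠₁ h :=
  (lComp Z f g).symm ≪≫ tIso (Iso.refl (𝟙 Z)) γ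

/-- `γ ⊗ Z` for `γ : f₁ ≫ f₂ ≫ f₃ ≅ g₁ ≫ g₂`. -/
def rMap₃ {f₁ : X₀ ⟶ X₁} {f₂ : X₁ ⟶ X₂} {f₃ : X₂ ⟶ X₃} {g₁ : X₀ ⟶ X₁'} {g₂ : X₁' ⟶ X₃}
    (γ : f₁ ≫ f₂ ≫ f₃ ≅ g₁ ≫ g₂) (Z : B) :
    (f₁ ⊠₁ 𝟙 Z) ≫ (f₂ ⊠₁ 𝟙 Z) ≫ (f₃ ⊠₁ 𝟙 Z) ≅ (g₁ ⊠₁ 𝟙 Z) ≫ (g₂ ⊠₁ 𝟙 Z) :=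
  whiskerLeftIso _ (rComp f₂ f₃ Z).symm ≪≫ rMap γ Z ≪≫ rComp g₁ g₂ Z

/-- `Z ⊗ γ` for `γ : f₁ ≫ f₂ ≫ f₃ ≅ g₁ ≫ g₂`. -/
def lMap₃ (Z : B) {f₁ : X₀ ⟶ X₁} {f₂ : X₁ ⟶ X₂} {f₃ : X₂ ⟶ X₃} {g₁ : X₀ ⟶ X₁'}
    {g₂ : X₁' ⟶ X₃} (γ : f₁ ≫ f₂ ≫ f₃ ≅ g₁ ≫ g₂) :
    (𝟙 Z ⊠₁ f₁) ≫ (𝟙 Z ⊠₁ f₂) ≫ (𝟙 Z ⊠₁ f₃) ≅ (𝟙 Z ⊠₁ g₁) ≫ (𝟙 Z ⊠₁ g₂) :=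
  whiskerLeftIso _ (lComp Z f₂ f₃).symm ≪≫ lMap Z γ ≪≫ lComp Z g₁ g₂

end Whisker

end Basic

end TensorBicategory

open TensorBicategory in

/-- A monoidal bicategory: a tensor product, unit, associator and unitors, together with invertible
modifications `π` (the 2-associator) and `lam`, `mu`, `rho` (the left, middle and right 2-unitors),
subject to the associahedron axiom and the two unit axioms. -/
class MonoidalBicategory (B : Type u) [Bicategory.{w, v} B] extends TensorBicategory B where
  /-- Component of the 2-associator. -/
  π (W X Y Z : B) :
    (assoc W X Y ⊠₁ 𝟙 Z) ≫ assoc W (X ⊠ Y) Z ≫ (𝟙 W ⊠₁ assoc X Y Z) ≅ assoc (W ⊠ X) Y Z ≫ assoc W X (Y ⊠ Z)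
  /-- Component of the left 2-unitor. -/
  lam (X Y : B) : lun X ⊠₁ 𝟙 Y ≅ assoc (I B) X Y ≫ lun (X ⊠ Y)
  /-- Component of the middle 2-unitor. -/
  mu (X Y : B) : assoc X (I B) Y ≫ (𝟙 X ⊠₁ lun Y) ≅ run X ⊠₁ 𝟙 Y
  /-- Component of the right 2-unitor. -/
  rho (X Y : B) : assoc X Y (I B) ≫ (𝟙 X ⊠₁ run Y) ≅ run (X ⊠ Y)
  /-- `π` is a modification. -/
  π_naturality {W W' X X' Y Y' Z Z' : B} (f : W ⟶ W') (g : X ⟶ X') (h : Y ⟶ Y') (k : Z ⟶ Z') :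
    (((f ⊠₁ g) ⊠₁ h) ⊠₁ k) ◁ (π W' X' Y' Z').hom ≫
        (compSq (aSq (f ⊠₁ g) h k) (aSq f g (h ⊠₁ k))).hom =
      (compSq (tSq (aSq f g h) (idSq k))
          (compSq (aSq f (g ⊠₁ h) k) (tSq (idSq f) (aSq g h k)))).hom ≫
        (π W X Y Z).hom ▷ (f ⊠₁ (g ⊠₁ (h ⊠₁ k)))
  /-- `lam` is a modification. -/
  lam_naturality {X X' Y Y' : B} (f : X ⟶ X') (g : Y ⟶ Y') :
    ((𝟙 (I B) ⊠₁ f) ⊠₁ g) ◁ (lam X' Y').hom ≫ (compSq (aSq (𝟙 (I B)) f g) (lSq (f ⊠₁ g))).hom =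
      (tSq (lSq f) (idSq g)).hom ≫ (lam X Y).hom ▷ (f ⊠₁ g)
  /-- `mu` is a modification. -/
  mu_naturality {X X' Y Y' : B} (f : X ⟶ X') (g : Y ⟶ Y') :
    ((f ⊠₁ 𝟙 (I B)) ⊠₁ g) ◁ (mu X' Y').hom ≫ (tSq (rSq f) (idSq g)).hom =
      (compSq (aSq f (𝟙 (I B)) g) (tSq (idSq f) (lSq g))).hom ≫ (mu X Y).hom ▷ (f ⊠₁ g)
  /-- `rho` is a modification. -/
  rho_naturality {X X' Y Y' : B} (f : X ⟶ X') (g : Y ⟶ Y') :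
    ((f ⊠₁ g) ⊠₁ 𝟙 (I B)) ◁ (rho X' Y').hom ≫ (rSq (f ⊠₁ g)).hom =
      (compSq (aSq f g (𝟙 (I B))) (tSq (idSq f) (rSq g))).hom ≫ (rho X Y).hom ▷ (f ⊠₁ g)
  /-- The associahedron axiom: the two ways of rewriting the longest path of associators
  `(((V ⊗ W) ⊗ X) ⊗ Y) ⊗ Z ⟶ V ⊗ (W ⊗ (X ⊗ (Y ⊗ Z)))` into the shortest one agree. -/
  associahedron (V W X Y Z : B) :
    (rMap₃ (π V W X Y) Z).hom ▷
          (assoc V (W ⊠ (X ⊠ Y)) Z ≫ (𝟙 V ⊠₁ assoc W (X ⊠ Y) Z) ≫ (𝟙 V ⊠₁ (𝟙 W ⊠₁ assoc X Y Z))) ⊗≫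
        (assoc (V ⊠ W) X Y ⊠₁ 𝟙 Z) ◁ (π V W (X ⊠ Y) Z).hom ▷ (𝟙 V ⊠₁ (𝟙 W ⊠₁ assoc X Y Z)) ⊗≫
        ((assoc (V ⊠ W) X Y ⊠₁ 𝟙 Z) ≫ assoc (V ⊠ W) (X ⊠ Y) Z) ◁
          (aSqRight V W (assoc X Y Z)).inv ⊗≫
        (π (V ⊠ W) X Y Z).hom ▷ assoc V W (X ⊠ (Y ⊠ Z)) =
      𝟙 _ ⊗≫
        (((assoc V W X ⊠₁ 𝟙 Y) ⊠₁ 𝟙 Z) ≫ (assoc V (W ⊠ X) Y ⊠₁ 𝟙 Z)) ◁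
          (aSq (𝟙 V) (assoc W X Y) (𝟙 Z)).hom ▷
            ((𝟙 V ⊠₁ assoc W (X ⊠ Y) Z) ≫ (𝟙 V ⊠₁ (𝟙 W ⊠₁ assoc X Y Z))) ⊗≫
        (((assoc V W X ⊠₁ 𝟙 Y) ⊠₁ 𝟙 Z) ≫ (assoc V (W ⊠ X) Y ⊠₁ 𝟙 Z) ≫ assoc V ((W ⊠ X) ⊠ Y) Z) ◁
          (lMap₃ V (π W X Y Z)).hom ⊗≫
        ((assoc V W X ⊠₁ 𝟙 Y) ⊠₁ 𝟙 Z) ◁ (π V (W ⊠ X) Y Z).hom ▷ (𝟙 V ⊠₁ assoc W X (Y ⊠ Z)) ⊗≫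
        (aSqLeft (assoc V W X) Y Z).hom ▷
          (assoc V (W ⊠ X) (Y ⊠ Z) ≫ (𝟙 V ⊠₁ assoc W X (Y ⊠ Z))) ⊗≫
        assoc ((V ⊠ W) ⊠ X) Y Z ◁ (π V W X (Y ⊠ Z)).hom ⊗≫ 𝟙 _
  /-- The left unit axiom: the two ways of rewriting
  `((X ⊗ I) ⊗ Y) ⊗ Z ⟶ X ⊗ (I ⊗ (Y ⊗ Z)) ⟶ X ⊗ (Y ⊗ Z)` agree. -/
  left_unit_axiom (X Y Z : B) :
    𝟙 _ ⊗≫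
        ((assoc X (I B) Y ⊠₁ 𝟙 Z) ≫ assoc X (I B ⊠ Y) Z) ◁ (lMap X (lam Y Z).symm).hom ⊗≫
        (assoc X (I B) Y ⊠₁ 𝟙 Z) ◁ (aSq (𝟙 X) (lun Y) (𝟙 Z)).inv ⊗≫
        (rMap (mu X Y) Z).hom ▷ assoc X Y Z =
      (π X (I B) Y Z).hom ▷ (𝟙 X ⊠₁ lun (Y ⊠ Z)) ⊗≫
        assoc (X ⊠ I B) Y Z ◁ (mu X (Y ⊠ Z)).hom ⊗≫
        (aSqLeft (run X) Y Z).inv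
  /-- The right unit axiom: the two ways of rewriting
  `((X ⊗ Y) ⊗ I) ⊗ Z ⟶ X ⊗ (Y ⊗ (I ⊗ Z)) ⟶ X ⊗ (Y ⊗ Z)` agree. -/
  right_unit_axiom (X Y Z : B) :
    𝟙 _ ⊗≫
        ((assoc X Y (I B) ⊠₁ 𝟙 Z) ≫ assoc X (Y ⊠ I B) Z) ◁ (lMap X (mu Y Z)).hom ⊗≫
        (assoc X Y (I B) ⊠₁ 𝟙 Z) ◁ (aSq (𝟙 X) (run Y) (𝟙 Z)).inv ⊗≫
        (rMap (rho X Y) Z).hom ▷ assoc X Y Z =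
      (π X Y (I B) Z).hom ▷ (𝟙 X ⊠₁ (𝟙 Y ⊠₁ lun Z)) ⊗≫
        assoc (X ⊠ Y) (I B) Z ◁ (aSqRight X Y (lun Z)).inv ⊗≫
        (mu (X ⊠ Y) Z).hom ▷ assoc X Y Z

namespace MonoidalBicategory

open TensorBicategory

section Interchangerator

variable {B : Type u} [Bicategory.{w, v} B] [TensorBicategory B]

/-- The interchangerator
`χ_{f,g} : (X' ⊗ g) ∘ (f ⊗ Y) ⇒ (f ⊗ Y') ∘ (X ⊗ g)`: join by the compositor of `⊗`, cancel
identities, and split by the compositor of `⊗`. -/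
def interchangerator {X X' Y Y' : B} (f : X ⟶ X') (g : Y ⟶ Y') :
    (f ⊠₁ 𝟙 Y) ≫ (𝟙 X' ⊠₁ g) ≅ (𝟙 X ⊠₁ g) ≫ (f ⊠₁ 𝟙 Y') :=
  (tComp f (𝟙 X') (𝟙 Y) g).symm ≪≫
    tIso (ρ_ f ≪≫ (λ_ f).symm) (λ_ g ≪≫ (ρ_ g).symm) ≪≫
    tComp (𝟙 X) f g (𝟙 Y')

end Interchangerator

variable {B : Type u} [Bicategory.{w, v} B] [MonoidalBicategory B]

/-- `θ₀ : l_X ⇒ r_X ∘ l_{X ⊗ I} ∘ a_{I,X,I} ∘ r•_{I ⊗ X}`, from the counit `r ∘ r• ≅ 1`, naturality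
of `r` at `l_X`, and the left 2-unitor. -/
def θ₀ (X : B) :
    lun X ≅ rInv (I B ⊠ X) ≫ (assoc (I B) X (I B) ≫ lun (X ⊠ I B)) ≫ run X :=
  (λ_ (lun X)).symm ≪≫ whiskerRightIso (rCounit (I B ⊠ X)).symm (lun X) ≪≫ α_ _ _ _ ≪≫
    whiskerLeftIso (rInv (I B ⊠ X)) ((rSq (lun X)).symm ≪≫ whiskerRightIso (lam X (I B)) (run X))

/-- `θ_l : l_{I ⊗ X} ⇒ I ⊗ l_X`, from naturality of `l` at `l_X`, cancelling `l_X` against `l•_X`. -/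
def θl (X : B) : lun (I B ⊠ X) ≅ 𝟙 (I B) ⊠₁ lun X :=
  (ρ_ _).symm ≪≫ whiskerLeftIso (lun (I B ⊠ X)) (lUnit X) ≪≫ (α_ _ _ _).symm ≪≫
    whiskerRightIso (lSq (lun X)).symm (lInv X) ≪≫ α_ _ _ _ ≪≫
    whiskerLeftIso (𝟙 (I B) ⊠₁ lun X) (lUnit X).symm ≪≫ ρ_ _

/-- `θ_r : r•_{X ⊗ I} ⇒ r•_X ⊗ I`, from naturality of `r•` at `r•_X`, cancelling `r•_X` against
`r_X`. -/
def θr (X : B) : rInv (X ⊠ I B) ≅ rInv X ⊠₁ 𝟙 (I B) :=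
  (λ_ _).symm ≪≫ whiskerRightIso (rUnit X) (rInv (X ⊠ I B)) ≪≫ α_ _ _ _ ≪≫
    whiskerLeftIso (run X) (rInvSq (rInv X)) ≪≫ (α_ _ _ _).symm ≪≫
    whiskerRightIso (rUnit X).symm (rInv X ⊠₁ 𝟙 (I B)) ≪≫ λ_ _

variable (B) in
/-- The invertible 2-cell `θ : l_I ⇒ r_I`: the component of `θ₀` at `I`, followed by those of `θ_l`
and `θ_r`, the middle 2-unitor `(I ⊗ l_I) ∘ a_{I,I,I} ≅ r_I ⊗ I`, and the counit `r_I ∘ r•_I ≅ 1`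
tensored with `I`. -/
def θ : lun (I B) ≅ run (I B) :=
  θ₀ (I B) ≪≫
    whiskerRightIso (θr (I B)) _ ≪≫
    whiskerLeftIso _ (whiskerRightIso (whiskerLeftIso _ (θl (I B)) ≪≫ mu (I B) (I B)) _) ≪≫
    (α_ _ _ _).symm ≪≫
    whiskerRightIso (rMap (rCounit (I B)) (I B) ≪≫ tId (I B) (I B)) (run (I B)) ≪≫
    λ_ (run (I B))

/-- The scalar braid `𝕏_{f,g} : g ∘ f ⇒ f ∘ g`. A loop, cup `1 ≅ r_I ∘ r•_I` and cap
`r_I ∘ r•_I ≅ 1`, is created to the right of both strings; its left leg is pulled over `f` as `r_I`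
and over `g` as `l_I`, so that `χ_{f,g}` applies to `f ⊗ I` and `I ⊗ g` inside the loop; then it is
pulled back. The 2-cell `θ` and its inverse change `l_I` to `r_I` and back. -/
def scalarBraid (f g : I B ⟶ I B) : f ≫ g ⟶ g ≫ f :=
  𝟙 _ ⊗≫
    (rCounit (I B)).inv ▷ (f ≫ g) ⊗≫
    rInv (I B) ◁ (rSq f).inv ▷ g ⊗≫
    (rInv (I B) ≫ (f ⊠₁ 𝟙 (I B))) ◁ (θ B).inv ▷ g ⊗≫
    (rInv (I B) ≫ (f ⊠₁ 𝟙 (I B))) ◁ (lSq g).inv ⊗≫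
    rInv (I B) ◁ (interchangerator f g).hom ▷ lun (I B) ⊗≫
    (rInv (I B) ≫ (𝟙 (I B) ⊠₁ g) ≫ (f ⊠₁ 𝟙 (I B))) ◁ (θ B).hom ⊗≫
    (rInv (I B) ≫ (𝟙 (I B) ⊠₁ g)) ◁ (rSq f).hom ⊗≫
    (rInv (I B) ≫ (𝟙 (I B) ⊠₁ g)) ◁ (θ B).inv ▷ f ⊗≫
    rInv (I B) ◁ (lSq g).hom ▷ f ⊗≫
    rInv (I B) ◁ (θ B).hom ▷ (g ≫ f) ⊗≫
    (rCounit (I B)).hom ▷ (g ≫ f) ⊗≫ 𝟙 _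

end MonoidalBicategory

end CategoryTheory

/-! The scalar braid is a conjugate. Write `F = f ⊠₁ 𝟙` and `G = 𝟙 ⊠₁ g`, both endomorphisms of `I ⊠
I`. Naturality of `r` slides `F` along `r_I` to `f`, and naturality of `l`, transported along `θ`,
slides `G` along the same `r_I` to `g`. Thus `χ : F ≫ G ⟶ G ≫ F` induces a 2-cell `r ≫ f ≫ g ⟶ r ≫ g
≫ f` (`slide`), and `scalarBraid f g` is its conjugate by the adjoint equivalence `r_I ⊣ r_I•`. By
the triangle identity, whiskering the braid with `r_I` returns the slide
(`whiskerLeft_scalarBraid`).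

Whiskering with `r_I` is faithful because `r_I•` is a one-sided inverse up to isomorphism, so every
identity between scalar braids may be tested on slides, where the loop has disappeared. There
naturality and the hexagons follow from the same properties of the three ingredients: the two
sliding squares are natural and compatible with composition because `r` and `l` are pseudonatural,
and `χ` is so because it is the image under `⊗` of a square of unitors in `B × B`. Of `θ` only its
invertibility enters: its occurrences cancel in pairs or move by interchange. -/

namespace CategoryTheory.Bicategory

/-! ### Sliding a crossing along a 1-cell -/

section Slide

variable {B : Type u} [Bicategory.{w, v} B] {I J : B} {r : J ⟶ I}

/-- The 2-cell `r ≫ f ≫ g ⟶ r ≫ g ≫ f` obtained from `χ : F ≫ G ⟶ G ≫ F` by sliding `F` and `G`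
along `r`. -/
def slide {f g : I ⟶ I} {F G : J ⟶ J} (s : F ≫ r ≅ r ≫ f) (t : G ≫ r ≅ r ≫ g)
    (χ : F ≫ G ⟶ G ≫ F) : r ≫ f ≫ g ⟶ r ≫ g ≫ f :=
  𝟙 _ ⊗≫ s.inv ▷ g ⊗≫ F ◁ t.inv ⊗≫ χ ▷ r ⊗≫ G ◁ s.hom ⊗≫ t.hom ▷ f ⊗≫ 𝟙 _

/-- The hypotheses carry the 2-cell through both copies of the `s`-square and through `χ`; it passes
the `t`-square by interchange. -/
theorem slide_naturality_left {f f' g : I ⟶ I} {F F' G : J ⟶ J} {s : F ≫ r ≅ r ≫ f}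
    {s' : F' ≫ r ≅ r ≫ f'} {t : G ≫ r ≅ r ≫ g} {χ : F ≫ G ⟶ G ≫ F} {χ' : F' ≫ G ⟶ G ≫ F'}
    {γ : f ⟶ f'} {Γ : F ⟶ F'} (hs : Γ ▷ r ≫ s'.hom = s.hom ≫ r ◁ γ)
    (hχ : Γ ▷ G ≫ χ' = χ ≫ G ◁ Γ) :
    r ◁ γ ▷ g ≫ slide s' t χ' = slide s t χ ≫ r ◁ g ◁ γ := by
  have hs' : r ◁ γ ≫ s'.inv = s.inv ≫ Γ ▷ r := by
    rw [Iso.comp_inv_eq, Category.assoc, hs, Iso.inv_hom_id_assoc]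
  calc
    _ = 𝟙 _ ⊗≫ (r ◁ γ ≫ s'.inv) ▷ g ⊗≫ F' ◁ t.inv ⊗≫ χ' ▷ r ⊗≫ G ◁ s'.hom ⊗≫ t.hom ▷ f' ⊗≫
        𝟙 _ := by
      simp only [slide]; bicategory
    _ = 𝟙 _ ⊗≫ s.inv ▷ g ⊗≫ (Γ ▷ (r ≫ g) ≫ F' ◁ t.inv) ⊗≫ χ' ▷ r ⊗≫ G ◁ s'.hom ⊗≫
        t.hom ▷ f' ⊗≫ 𝟙 _ := by
      rw [hs']; bicategory
    _ = 𝟙 _ ⊗≫ s.inv ▷ g ⊗≫ F ◁ t.inv ⊗≫ (Γ ▷ G ≫ χ') ▷ r ⊗≫ G ◁ s'.hom ⊗≫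
        t.hom ▷ f' ⊗≫ 𝟙 _ := by
      rw [← whisker_exchange]; bicategory
    _ = 𝟙 _ ⊗≫ s.inv ▷ g ⊗≫ F ◁ t.inv ⊗≫ χ ▷ r ⊗≫ G ◁ (Γ ▷ r ≫ s'.hom) ⊗≫
        t.hom ▷ f' ⊗≫ 𝟙 _ := by
      rw [hχ]; bicategory
    _ = 𝟙 _ ⊗≫ s.inv ▷ g ⊗≫ F ◁ t.inv ⊗≫ χ ▷ r ⊗≫ G ◁ s.hom ⊗≫
        ((G ≫ r) ◁ γ ≫ t.hom ▷ f') ⊗≫ 𝟙 _ := by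
      rw [hs]; bicategory
    _ = _ := by
      rw [whisker_exchange, slide]; bicategory

theorem slide_naturality_right {f g g' : I ⟶ I} {F G G' : J ⟶ J} {s : F ≫ r ≅ r ≫ f}
    {t : G ≫ r ≅ r ≫ g} {t' : G' ≫ r ≅ r ≫ g'} {χ : F ≫ G ⟶ G ≫ F} {χ' : F ≫ G' ⟶ G' ≫ F}
    {γ : g ⟶ g'} {Γ : G ⟶ G'} (ht : Γ ▷ r ≫ t'.hom = t.hom ≫ r ◁ γ)
    (hχ : F ◁ Γ ≫ χ' = χ ≫ Γ ▷ F) :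
    r ◁ f ◁ γ ≫ slide s t' χ' = slide s t χ ≫ r ◁ γ ▷ f := by
  have ht' : r ◁ γ ≫ t'.inv = t.inv ≫ Γ ▷ r := by
    rw [Iso.comp_inv_eq, Category.assoc, ht, Iso.inv_hom_id_assoc]
  calc
    _ = 𝟙 _ ⊗≫ ((r ≫ f) ◁ γ ≫ s.inv ▷ g') ⊗≫ F ◁ t'.inv ⊗≫ χ' ▷ r ⊗≫ G' ◁ s.hom ⊗≫
        t'.hom ▷ f ⊗≫ 𝟙 _ := by
      simp only [slide]; bicategory
    _ = 𝟙 _ ⊗≫ s.inv ▷ g ⊗≫ F ◁ (r ◁ γ ≫ t'.inv) ⊗≫ χ' ▷ r ⊗≫ G' ◁ s.hom ⊗≫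
        t'.hom ▷ f ⊗≫ 𝟙 _ := by
      rw [whisker_exchange]; bicategory
    _ = 𝟙 _ ⊗≫ s.inv ▷ g ⊗≫ F ◁ t.inv ⊗≫ (F ◁ Γ ≫ χ') ▷ r ⊗≫ G' ◁ s.hom ⊗≫
        t'.hom ▷ f ⊗≫ 𝟙 _ := by
      rw [ht']; bicategory
    _ = 𝟙 _ ⊗≫ s.inv ▷ g ⊗≫ F ◁ t.inv ⊗≫ χ ▷ r ⊗≫ (Γ ▷ (F ≫ r) ≫ G' ◁ s.hom) ⊗≫
        t'.hom ▷ f ⊗≫ 𝟙 _ := by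
      rw [hχ]; bicategory
    _ = 𝟙 _ ⊗≫ s.inv ▷ g ⊗≫ F ◁ t.inv ⊗≫ χ ▷ r ⊗≫ G ◁ s.hom ⊗≫
        (Γ ▷ r ≫ t'.hom) ▷ f ⊗≫ 𝟙 _ := by
      rw [← whisker_exchange]; bicategory
    _ = _ := by
      rw [ht, slide]; bicategory

/-- Sliding past a composite `g ≫ h`. -/
theorem slide_comp_right {f g h : I ⟶ I} {F G H K : J ⟶ J} {s : F ≫ r ≅ r ≫ f}
    {t : G ≫ r ≅ r ≫ g} {u : H ≫ r ≅ r ≫ h} {k : K ≫ r ≅ r ≫ g ≫ h} (c : K ≅ G ≫ H)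
    {χ : F ≫ G ⟶ G ≫ F} {χ' : F ≫ H ⟶ H ≫ F} {χ'' : F ≫ K ⟶ K ≫ F}
    (hk : k.hom = c.hom ▷ r ⊗≫ G ◁ u.hom ⊗≫ t.hom ▷ h ⊗≫ 𝟙 _)
    (hχ : χ'' = F ◁ c.hom ⊗≫ χ ▷ H ⊗≫ G ◁ χ' ⊗≫ c.inv ▷ F)
    {x : f ≫ h ⟶ h ≫ f} (hx : r ◁ x = slide s u χ') :
    slide s k χ'' = 𝟙 _ ⊗≫ slide s t χ ▷ h ⊗≫ r ◁ g ◁ x ⊗≫ 𝟙 _ := by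
  -- `hk` presents `k` as a pasting of invertible cells, so its inverse is the reversed pasting.
  have hk' : k.inv = 𝟙 _ ⊗≫ t.inv ▷ h ⊗≫ G ◁ u.inv ⊗≫ c.inv ▷ r := by
    rw [← cancel_epi k.hom, Iso.hom_inv_id, hk]
    symm
    calc
      _ = c.hom ▷ r ⊗≫ G ◁ u.hom ⊗≫ (t.hom ≫ t.inv) ▷ h ⊗≫ G ◁ u.inv ⊗≫ c.inv ▷ r := by
        bicategory
      _ = c.hom ▷ r ⊗≫ G ◁ (u.hom ≫ u.inv) ⊗≫ c.inv ▷ r := by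
        rw [Iso.hom_inv_id]; bicategory
      _ = (c.hom ≫ c.inv) ▷ r := by
        rw [Iso.hom_inv_id]; bicategory
      _ = 𝟙 _ := by
        rw [Iso.hom_inv_id]; bicategory
  symm
  calc
    _ = 𝟙 _ ⊗≫ s.inv ▷ g ▷ h ⊗≫ F ◁ t.inv ▷ h ⊗≫ χ ▷ r ▷ h ⊗≫ G ◁ s.hom ▷ h ⊗≫
        (t.hom ▷ (f ≫ h) ≫ (r ≫ g) ◁ x) ⊗≫ 𝟙 _ := by
      rw [slide]; bicategory
    -- Moving `x` ahead of `t.hom` exposes `r ◁ x`, which `hx` turns into a second slide; its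
    -- initial `s.inv` then cancels the `s.hom` of the first.
    _ = 𝟙 _ ⊗≫ s.inv ▷ g ▷ h ⊗≫ F ◁ t.inv ▷ h ⊗≫ χ ▷ r ▷ h ⊗≫ G ◁ s.hom ▷ h ⊗≫
        G ◁ (r ◁ x) ⊗≫ t.hom ▷ (h ≫ f) ⊗≫ 𝟙 _ := by
      rw [← whisker_exchange]; bicategory
    _ = 𝟙 _ ⊗≫ s.inv ▷ g ▷ h ⊗≫ F ◁ t.inv ▷ h ⊗≫ χ ▷ r ▷ h ⊗≫ G ◁ (s.hom ≫ s.inv) ▷ h ⊗≫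
        G ◁ F ◁ u.inv ⊗≫ G ◁ χ' ▷ r ⊗≫ G ◁ H ◁ s.hom ⊗≫ G ◁ u.hom ▷ f ⊗≫
        t.hom ▷ (h ≫ f) ⊗≫ 𝟙 _ := by
      rw [hx, slide]; bicategory
    _ = 𝟙 _ ⊗≫ s.inv ▷ g ▷ h ⊗≫ F ◁ t.inv ▷ h ⊗≫ (χ ▷ (r ≫ h) ≫ (G ≫ F) ◁ u.inv) ⊗≫
        G ◁ χ' ▷ r ⊗≫ G ◁ H ◁ s.hom ⊗≫ G ◁ u.hom ▷ f ⊗≫ t.hom ▷ (h ≫ f) ⊗≫ 𝟙 _ := by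
      rw [Iso.hom_inv_id]; bicategory
    -- The two identities of `G ≫ H` are placeholders for `c.inv ≫ c.hom`. The outer factors go to
    -- `k.inv` and `k.hom`, the inner ones to `χ''`.
    _ = 𝟙 _ ⊗≫ s.inv ▷ (g ≫ h) ⊗≫ F ◁ t.inv ▷ h ⊗≫ F ◁ G ◁ u.inv ⊗≫
        F ◁ 𝟙 (G ≫ H) ▷ r ⊗≫ χ ▷ H ▷ r ⊗≫ G ◁ χ' ▷ r ⊗≫ 𝟙 (G ≫ H) ▷ F ▷ r ⊗≫ (G ≫ H) ◁ s.hom ⊗≫ G ◁ u.hom ▷ f ⊗≫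
        t.hom ▷ (h ≫ f) ⊗≫ 𝟙 _ := by
      rw [← whisker_exchange]; bicategory
    _ = 𝟙 _ ⊗≫ s.inv ▷ (g ≫ h) ⊗≫ F ◁ t.inv ▷ h ⊗≫ F ◁ G ◁ u.inv ⊗≫
        F ◁ (c.inv ≫ c.hom) ▷ r ⊗≫ χ ▷ H ▷ r ⊗≫ G ◁ χ' ▷ r ⊗≫ c.inv ▷ F ▷ r ⊗≫ (c.hom ▷ (F ≫ r) ≫ (G ≫ H) ◁ s.hom) ⊗≫
        G ◁ u.hom ▷ f ⊗≫ t.hom ▷ (h ≫ f) ⊗≫ 𝟙 _ := by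
      rw [← c.inv_hom_id]; bicategory
    _ = 𝟙 _ ⊗≫ s.inv ▷ (g ≫ h) ⊗≫ F ◁ t.inv ▷ h ⊗≫ F ◁ G ◁ u.inv ⊗≫
        F ◁ (c.inv ≫ c.hom) ▷ r ⊗≫ χ ▷ H ▷ r ⊗≫ G ◁ χ' ▷ r ⊗≫ c.inv ▷ F ▷ r ⊗≫
        K ◁ s.hom ⊗≫ c.hom ▷ r ▷ f ⊗≫ G ◁ u.hom ▷ f ⊗≫ t.hom ▷ (h ≫ f) ⊗≫ 𝟙 _ := by
      rw [← whisker_exchange]; bicategory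
    _ = _ := by
      rw [slide, hk, hk', hχ]; bicategory

/-- Sliding a composite `f ≫ g` past `h`. -/
theorem slide_comp_left {f g h : I ⟶ I} {F G H K : J ⟶ J} {s : F ≫ r ≅ r ≫ f}
    {t : G ≫ r ≅ r ≫ g} {u : H ≫ r ≅ r ≫ h} {k : K ≫ r ≅ r ≫ f ≫ g} (c : K ≅ F ≫ G)
    {χ : G ≫ H ⟶ H ≫ G} {χ' : F ≫ H ⟶ H ≫ F} {χ'' : K ≫ H ⟶ H ≫ K}
    (hk : k.hom = c.hom ▷ r ⊗≫ F ◁ t.hom ⊗≫ s.hom ▷ g ⊗≫ 𝟙 _)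
    (hχ : χ'' = c.hom ▷ H ⊗≫ F ◁ χ ⊗≫ χ' ▷ G ⊗≫ H ◁ c.inv)
    {x : g ≫ h ⟶ h ≫ g} (hx : r ◁ x = slide t u χ) :
    slide k u χ'' = 𝟙 _ ⊗≫ r ◁ f ◁ x ⊗≫ slide s u χ' ▷ g ⊗≫ 𝟙 _ := by
  have hk' : k.inv = 𝟙 _ ⊗≫ s.inv ▷ g ⊗≫ F ◁ t.inv ⊗≫ c.inv ▷ r := by
    rw [← cancel_epi k.hom, Iso.hom_inv_id, hk]
    symm
    calc
      _ = c.hom ▷ r ⊗≫ F ◁ t.hom ⊗≫ (s.hom ≫ s.inv) ▷ g ⊗≫ F ◁ t.inv ⊗≫ c.inv ▷ r := by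
        bicategory
      _ = c.hom ▷ r ⊗≫ F ◁ (t.hom ≫ t.inv) ⊗≫ c.inv ▷ r := by
        rw [Iso.hom_inv_id]; bicategory
      _ = (c.hom ≫ c.inv) ▷ r := by
        rw [Iso.hom_inv_id]; bicategory
      _ = 𝟙 _ := by
        rw [Iso.hom_inv_id]; bicategory
  symm
  calc
    _ = 𝟙 _ ⊗≫ ((r ≫ f) ◁ x ≫ s.inv ▷ (h ≫ g)) ⊗≫ F ◁ u.inv ▷ g ⊗≫ χ' ▷ r ▷ g ⊗≫
        H ◁ s.hom ▷ g ⊗≫ u.hom ▷ f ▷ g ⊗≫ 𝟙 _ := by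
      rw [slide]; bicategory
    -- Here `x` moves past `s.inv` to expose `r ◁ x`; the pair that cancels between the two slides
    -- is now `u.hom ≫ u.inv`.
    _ = 𝟙 _ ⊗≫ s.inv ▷ (g ≫ h) ⊗≫ F ◁ (r ◁ x) ⊗≫ F ◁ u.inv ▷ g ⊗≫ χ' ▷ r ▷ g ⊗≫
        H ◁ s.hom ▷ g ⊗≫ u.hom ▷ f ▷ g ⊗≫ 𝟙 _ := by
      rw [whisker_exchange]; bicategory
    _ = 𝟙 _ ⊗≫ s.inv ▷ (g ≫ h) ⊗≫ F ◁ t.inv ▷ h ⊗≫ F ◁ G ◁ u.inv ⊗≫ F ◁ χ ▷ r ⊗≫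
        F ◁ H ◁ t.hom ⊗≫ F ◁ (u.hom ≫ u.inv) ▷ g ⊗≫ χ' ▷ r ▷ g ⊗≫
        H ◁ s.hom ▷ g ⊗≫ u.hom ▷ f ▷ g ⊗≫ 𝟙 _ := by
      rw [hx, slide]; bicategory
    _ = 𝟙 _ ⊗≫ s.inv ▷ (g ≫ h) ⊗≫ F ◁ t.inv ▷ h ⊗≫ F ◁ G ◁ u.inv ⊗≫ F ◁ χ ▷ r ⊗≫
        ((F ≫ H) ◁ t.hom ≫ χ' ▷ (r ≫ g)) ⊗≫ H ◁ s.hom ▷ g ⊗≫ u.hom ▷ f ▷ g ⊗≫ 𝟙 _ := by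
      rw [Iso.hom_inv_id]; bicategory
    _ = 𝟙 _ ⊗≫ s.inv ▷ (g ≫ h) ⊗≫ F ◁ t.inv ▷ h ⊗≫ (F ≫ G) ◁ u.inv ⊗≫ 𝟙 (F ≫ G) ▷ H ▷ r ⊗≫
        F ◁ χ ▷ r ⊗≫ χ' ▷ G ▷ r ⊗≫ H ◁ 𝟙 (F ≫ G) ▷ r ⊗≫ H ◁ F ◁ t.hom ⊗≫ H ◁ s.hom ▷ g ⊗≫ u.hom ▷ f ▷ g ⊗≫ 𝟙 _ := by
      rw [whisker_exchange]; bicategory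
    _ = 𝟙 _ ⊗≫ s.inv ▷ (g ≫ h) ⊗≫ F ◁ t.inv ▷ h ⊗≫ ((F ≫ G) ◁ u.inv ≫ c.inv ▷ (H ≫ r)) ⊗≫
        c.hom ▷ H ▷ r ⊗≫ F ◁ χ ▷ r ⊗≫ χ' ▷ G ▷ r ⊗≫ H ◁ (c.inv ≫ c.hom) ▷ r ⊗≫
        H ◁ F ◁ t.hom ⊗≫ H ◁ s.hom ▷ g ⊗≫ u.hom ▷ f ▷ g ⊗≫ 𝟙 _ := by
      rw [← c.inv_hom_id]; bicategory
    _ = 𝟙 _ ⊗≫ s.inv ▷ (g ≫ h) ⊗≫ F ◁ t.inv ▷ h ⊗≫ c.inv ▷ (r ≫ h) ⊗≫ K ◁ u.inv ⊗≫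
        c.hom ▷ H ▷ r ⊗≫ F ◁ χ ▷ r ⊗≫ χ' ▷ G ▷ r ⊗≫ H ◁ (c.inv ≫ c.hom) ▷ r ⊗≫
        H ◁ F ◁ t.hom ⊗≫ H ◁ s.hom ▷ g ⊗≫ u.hom ▷ f ▷ g ⊗≫ 𝟙 _ := by
      rw [whisker_exchange]; bicategory
    _ = _ := by
      rw [slide, hk, hk', hχ]; bicategory

end Slide

/-! ### Whiskering with an equivalence -/

section Conjugation

variable {B : Type u} [Bicategory.{w, v} B] {I J : B}

/-- Whiskering with a 1-cell `r` such that `r' ≫ r ≅ 𝟙 I` for some `r'` is faithful. -/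
theorem whiskerLeft_injective_of_rightInverse {K : B} {r : J ⟶ I} {r' : I ⟶ J} (e : r' ≫ r ≅ 𝟙 I)
    {f g : I ⟶ K} {α β : f ⟶ g} (h : r ◁ α = r ◁ β) : α = β := by
  -- Conjugation by `e` recovers `γ` from `r ◁ γ`.
  have key (γ : f ⟶ g) : γ = 𝟙 _ ⊗≫ e.inv ▷ f ⊗≫ r' ◁ (r ◁ γ) ⊗≫ e.hom ▷ g ⊗≫ 𝟙 _ := by
    symm
    calc
      _ = 𝟙 _ ⊗≫ e.inv ▷ f ⊗≫ ((r' ≫ r) ◁ γ ≫ e.hom ▷ g) ⊗≫ 𝟙 _ := by bicategory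
      _ = 𝟙 _ ⊗≫ (e.inv ≫ e.hom) ▷ f ⊗≫ γ := by rw [whisker_exchange]; bicategory
      _ = γ := by rw [Iso.inv_hom_id]; bicategory
  rw [key α, key β, h]

/-- Conjugating `τ : r ≫ f ⟶ r ≫ g` with an equivalence inverse to `r` and whiskering with `r` gives
back `τ`. -/
theorem whiskerLeft_conj {K : B} (e : J ≌ I) {f g : I ⟶ K} (τ : e.hom ≫ f ⟶ e.hom ≫ g) :
    e.hom ◁ (𝟙 _ ⊗≫ e.counit.inv ▷ f ⊗≫ e.inv ◁ τ ⊗≫ e.counit.hom ▷ g ⊗≫ 𝟙 _) = τ := by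
  -- The triangle identity trades the whiskered counit for the inverse unit, which can then move
  -- past `τ` by interchange and cancel.
  have h₁ : e.hom ◁ e.counit.hom = 𝟙 _ ⊗≫ e.unit.inv ▷ e.hom ⊗≫ 𝟙 _ := by
    have := e.left_triangle_hom
    rw [leftZigzag] at this
    calc
      _ = 𝟙 _ ⊗≫ 𝟙 (e.hom ≫ e.inv) ▷ e.hom ⊗≫ e.hom ◁ e.counit.hom := by bicategory
      _ = 𝟙 _ ⊗≫ e.unit.inv ▷ e.hom ⊗≫ (e.unit.hom ▷ e.hom ⊗≫ e.hom ◁ e.counit.hom) := by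
        rw [← e.unit.inv_hom_id]; bicategory
      _ = _ := by rw [this]; bicategory
  have h₂ : e.hom ◁ e.counit.inv = 𝟙 _ ⊗≫ e.unit.hom ▷ e.hom ⊗≫ 𝟙 _ := by
    rw [← cancel_mono (e.hom ◁ e.counit.hom), ← Bicategory.whiskerLeft_comp, Iso.inv_hom_id, h₁]
    symm
    calc
      _ = 𝟙 _ ⊗≫ (e.unit.hom ≫ e.unit.inv) ▷ e.hom ⊗≫ 𝟙 _ := by bicategory
      _ = _ := by rw [Iso.hom_inv_id]; bicategory
  calc
    _ = 𝟙 _ ⊗≫ e.hom ◁ e.counit.inv ▷ f ⊗≫ (e.hom ≫ e.inv) ◁ τ ⊗≫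
        (e.hom ◁ e.counit.hom) ▷ g ⊗≫ 𝟙 _ := by bicategory
    _ = 𝟙 _ ⊗≫ (e.hom ◁ e.counit.inv) ▷ f ⊗≫ ((e.hom ≫ e.inv) ◁ τ ≫
        e.unit.inv ▷ (e.hom ≫ g)) ⊗≫ 𝟙 _ := by rw [h₁]; bicategory
    _ = 𝟙 _ ⊗≫ (e.unit.hom ≫ e.unit.inv) ▷ e.hom ▷ f ⊗≫ τ := by
      rw [whisker_exchange, h₂]; bicategory
    _ = τ := by rw [Iso.hom_inv_id]; bicategory

end Conjugation

end CategoryTheory.Bicategory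

namespace CategoryTheory.Pseudofunctor

/-! ### Images of squares under a pseudofunctor -/

section MapSquare

variable {B : Type u₁} [Bicategory.{w₁, v₁} B] {C : Type u₂} [Bicategory.{w₂, v₂} C] (F : B ⥤ᵖ C)

theorem map₂_associator_symm {a b c d : B} (f : a ⟶ b) (g : b ⟶ c) (h : c ⟶ d) :
    F.map₂ (α_ f g h).inv = (F.mapComp f (g ≫ h)).hom ≫ F.map f ◁ (F.mapComp g h).hom ≫
      (α_ (F.map f) (F.map g) (F.map h)).inv ≫ (F.mapComp f g).inv ▷ F.map h ≫
      (F.mapComp (f ≫ g) h).inv := by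
  rw [← cancel_epi (F.map₂ (α_ f g h).hom), ← F.map₂_comp, Iso.hom_inv_id]
  simp

/-- The image of a square under a pseudofunctor. -/
def mapSquare {a a' b b' : B} {p : a ⟶ a'} {q : a' ⟶ b'} {q' : a ⟶ b} {p' : b ⟶ b'}
    (γ : p ≫ q ⟶ q' ≫ p') : F.map p ≫ F.map q ⟶ F.map q' ≫ F.map p' :=
  (F.mapComp p q).inv ≫ F.map₂ γ ≫ (F.mapComp q' p').hom

variable {a a' b b' c c' : B}

/-- A pseudofunctor preserves pasting. The isomorphisms `e`, `e'` are needed because in `B × B` the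
1-cell `(𝟙, g ≫ h)` is only isomorphic to `(𝟙, g) ≫ (𝟙, h)`. -/
theorem mapSquare_paste_right {p : a ⟶ a'} {q : a' ⟶ b'} {q' : a ⟶ b}
    {p' : b ⟶ b'} {s : b' ⟶ c'} {s' : b ⟶ c} {p'' : c ⟶ c'} {k : a' ⟶ c'} {k' : a ⟶ c}
    (e : k ≅ q ≫ s) (e' : k' ≅ q' ≫ s') {γ : p ≫ q ⟶ q' ≫ p'} {δ : p' ≫ s ⟶ s' ≫ p''}
    {κ : p ≫ k ⟶ k' ≫ p''}
    (hκ : κ = p ◁ e.hom ≫ (α_ p q s).inv ≫ γ ▷ s ≫ (α_ q' p' s).hom ≫ q' ◁ δ ≫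
      (α_ q' s' p'').inv ≫ e'.inv ▷ p'') :
    F.mapSquare κ = F.map p ◁ (F.map₂Iso e ≪≫ F.mapComp q s).hom ≫ (α_ _ _ _).inv ≫
      F.mapSquare γ ▷ F.map s ≫ (α_ _ _ _).hom ≫ F.map q' ◁ F.mapSquare δ ≫
      (α_ _ _ _).inv ≫ (F.map₂Iso e' ≪≫ F.mapComp q' s').inv ▷ F.map p'' := by
  subst hκ
  simp [mapSquare, map₂_associator_symm]

theorem mapSquare_paste_left {p : a ⟶ b} {k : a ⟶ c} {q : c ⟶ c'} {p₂ : b ⟶ c} {q' : b ⟶ b'}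
    {p₂' : b' ⟶ c'} {q'' : a ⟶ a'} {p' : a' ⟶ b'} {k' : a' ⟶ c'}
    (e : k ≅ p ≫ p₂) (e' : k' ≅ p' ≫ p₂') {γ : p ≫ q' ⟶ q'' ≫ p'} {δ : p₂ ≫ q ⟶ q' ≫ p₂'}
    {κ : k ≫ q ⟶ q'' ≫ k'}
    (hκ : κ = e.hom ▷ q ≫ (α_ p p₂ q).hom ≫ p ◁ δ ≫ (α_ p q' p₂').inv ≫ γ ▷ p₂' ≫
      (α_ q'' p' p₂').hom ≫ q'' ◁ e'.inv) :
    F.mapSquare κ = (F.map₂Iso e ≪≫ F.mapComp p p₂).hom ▷ F.map q ≫ (α_ _ _ _).hom ≫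
      F.map p ◁ F.mapSquare δ ≫ (α_ _ _ _).inv ≫ F.mapSquare γ ▷ F.map p₂' ≫
      (α_ _ _ _).hom ≫ F.map q'' ◁ (F.map₂Iso e' ≪≫ F.mapComp p' p₂').inv := by
  subst hκ
  simp [mapSquare, map₂_associator_symm]

theorem mapSquare_naturality_left {p p₁ : a ⟶ a'} {q : a' ⟶ b'} {q' : a ⟶ b} {p' p₁' : b ⟶ b'}
    {γ : p ≫ q ⟶ q' ≫ p'} {γ₁ : p₁ ≫ q ⟶ q' ≫ p₁'} {Γ : p ⟶ p₁} {Γ' : p' ⟶ p₁'}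
    (h : Γ ▷ q ≫ γ₁ = γ ≫ q' ◁ Γ') :
    F.map₂ Γ ▷ F.map q ≫ F.mapSquare γ₁ = F.mapSquare γ ≫ F.map q' ◁ F.map₂ Γ' := by
  have h' := congrArg (F.map₂ ·) h
  simp only [F.map₂_comp, F.map₂_whisker_left, F.map₂_whisker_right, Category.assoc,
    ← Iso.eq_inv_comp] at h'
  simp [mapSquare, reassoc_of% h']

theorem mapSquare_naturality_right {p : a ⟶ a'} {q q₁ : a' ⟶ b'} {q' q₁' : a ⟶ b} {p' : b ⟶ b'}
    {γ : p ≫ q ⟶ q' ≫ p'} {γ₁ : p ≫ q₁ ⟶ q₁' ≫ p'} {Γ : q ⟶ q₁} {Γ' : q' ⟶ q₁'}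
    (h : p ◁ Γ ≫ γ₁ = γ ≫ Γ' ▷ p') :
    F.map p ◁ F.map₂ Γ ≫ F.mapSquare γ₁ = F.mapSquare γ ≫ F.map₂ Γ' ▷ F.map p' := by
  have h' := congrArg (F.map₂ ·) h
  simp only [F.map₂_comp, F.map₂_whisker_left, F.map₂_whisker_right, Category.assoc,
    ← Iso.eq_inv_comp] at h'
  simp [mapSquare, reassoc_of% h']

end MapSquare

end CategoryTheory.Pseudofunctor

/-! ### Pseudonaturality of the unitors -/

namespace CategoryTheory.TensorBicategory

variable {B : Type u} [Bicategory.{w, v} B] [TensorBicategory B]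

/-- Tensor product of 2-cells. -/
def tMap {X X' Y Y' : B} {f f' : X ⟶ X'} {g g' : Y ⟶ Y'} (γ : f ⟶ f') (δ : g ⟶ g') :
    f ⊠₁ g ⟶ f' ⊠₁ g' :=
  tensor.map₂ (a := (X, Y)) (b := (X', Y')) (f := (f, g)) (g := (f', g')) (Prod.mkHom γ δ)

theorem rSq_naturality {X X' : B} {f f' : X ⟶ X'} (γ : f ⟶ f') :
    tMap γ (𝟙 (𝟙 (I B))) ▷ run X' ≫ (rSq f').hom = (rSq f).hom ≫ run X ◁ γ :=
  (rightEquiv (B := B)).hom.naturality_naturality γ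

theorem lSq_naturality {X X' : B} {f f' : X ⟶ X'} (γ : f ⟶ f') :
    tMap (𝟙 (𝟙 (I B))) γ ▷ lun X' ≫ (lSq f').hom = (lSq f).hom ≫ lun X ◁ γ :=
  (leftEquiv (B := B)).hom.naturality_naturality γ

theorem rSq_comp {X X' X'' : B} (f : X ⟶ X') (g : X' ⟶ X'') :
    (rSq (f ≫ g)).hom = (rComp f g (I B)).hom ▷ run X'' ⊗≫ (f ⊠₁ 𝟙 (I B)) ◁ (rSq g).hom ⊗≫
      (rSq f).hom ▷ g ⊗≫ 𝟙 _ := by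
  have h : (rSq (f ≫ g)).hom ≫ run X ◁ 𝟙 (f ≫ g) =
      (rComp f g (I B)).hom ▷ run X'' ≫ (α_ _ _ _).hom ≫ (f ⊠₁ 𝟙 (I B)) ◁ (rSq g).hom ≫
        (α_ _ _ _).inv ≫ (rSq f).hom ▷ g ≫ (α_ _ _ _).hom :=
    (rightEquiv (B := B)).hom.naturality_comp f g
  rw [Bicategory.whiskerLeft_id, Category.comp_id] at h
  rw [h]; bicategory

theorem lSq_comp {X X' X'' : B} (f : X ⟶ X') (g : X' ⟶ X'') :
    (lSq (f ≫ g)).hom = (lComp (I B) f g).hom ▷ lun X'' ⊗≫ (𝟙 (I B) ⊠₁ f) ◁ (lSq g).hom ⊗≫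
      (lSq f).hom ▷ g ⊗≫ 𝟙 _ := by
  have h : (lSq (f ≫ g)).hom ≫ lun X ◁ 𝟙 (f ≫ g) =
      (tensor.map₂ (a := (I B, X)) (b := (I B, X'')) (Prod.mkHom (ρ_ (𝟙 (I B))).inv (𝟙 (f ≫ g))) ≫
          (tComp (𝟙 (I B)) (𝟙 (I B)) f g).hom) ▷ lun X'' ≫
        (α_ _ _ _).hom ≫ (𝟙 (I B) ⊠₁ f) ◁ (lSq g).hom ≫
        (α_ _ _ _).inv ≫ (lSq f).hom ▷ g ≫ (α_ _ _ _).hom :=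
    (leftEquiv (B := B)).hom.naturality_comp f g
  -- The compositor of `I ⊗ -` obtained from `sectR` splits `𝟙 I` by a right unitor, whereas `lComp`
  -- uses the left one; they agree at an identity.
  rw [Bicategory.whiskerLeft_id, Category.comp_id, ← unitors_inv_equal] at h
  change _ = (lComp (I B) f g).hom ▷ _ ≫ _ at h
  rw [h]; bicategory

/-- The right unitor at the unit object as an equivalence. -/
def rightUnitorEquivalence (X : B) : (X ⊠ I B) ≌ X where
  hom := run X
  inv := rInv X
  unit := rUnit X
  counit := rCounit X
  left_triangle := by
    ext
    -- The triangle identity is an equation of modifications; only its component at `X` is needed.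
    have h := congrArg (fun m => m.as.app X) (rightEquiv (B := B)).left_triangle_hom
    simp [leftZigzag, bicategoricalComp] at h ⊢
    exact h

end CategoryTheory.TensorBicategory

namespace CategoryTheory.MonoidalBicategory

open TensorBicategory

/-! ### Naturality and composition laws of the interchangerator -/

section Interchangerator

variable {B : Type u} [Bicategory.{w, v} B] [TensorBicategory B]

/-- The interchangerator unfolds to `mapSquare` of `⊗` at a square of unitors in `B × B`, so the
claim reduces to coherence in each factor. The next three lemmas rest on the same observation. -/
theorem interchangerator_naturality_left {X X' Y Y' : B} {f f' : X ⟶ X'} (γ : f ⟶ f')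
    (g : Y ⟶ Y') :
    tMap γ (𝟙 (𝟙 Y)) ▷ (𝟙 X' ⊠₁ g) ≫ (interchangerator f' g).hom =
      (interchangerator f g).hom ≫ (𝟙 X ⊠₁ g) ◁ tMap γ (𝟙 (𝟙 Y')) :=
  (tensor (B := B)).mapSquare_naturality_left (a := (X, Y)) (a' := (X', Y)) (b := (X, Y'))
    (b' := (X', Y')) (p := (f, 𝟙 Y)) (p₁ := (f', 𝟙 Y)) (q := (𝟙 X', g)) (q' := (𝟙 X, g))
    (p' := (f, 𝟙 Y')) (p₁' := (f', 𝟙 Y')) (Γ := Prod.mkHom γ (𝟙 (𝟙 Y)))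
    (Γ' := Prod.mkHom γ (𝟙 (𝟙 Y')))
    (γ := Prod.mkHom ((ρ_ f).hom ≫ (λ_ f).inv) ((λ_ g).hom ≫ (ρ_ g).inv))
    (γ₁ := Prod.mkHom ((ρ_ f').hom ≫ (λ_ f').inv) ((λ_ g).hom ≫ (ρ_ g).inv))
    (by
      refine Prod.ext ?_ ?_
      · change γ ▷ 𝟙 X' ≫ (ρ_ f').hom ≫ (λ_ f').inv = ((ρ_ f).hom ≫ (λ_ f).inv) ≫ 𝟙 X ◁ γ
        bicategory
      · change 𝟙 (𝟙 Y) ▷ g ≫ (λ_ g).hom ≫ (ρ_ g).inv =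
          ((λ_ g).hom ≫ (ρ_ g).inv) ≫ g ◁ 𝟙 (𝟙 Y')
        bicategory)

theorem interchangerator_naturality_right {X X' Y Y' : B} (f : X ⟶ X') {g g' : Y ⟶ Y'}
    (γ : g ⟶ g') :
    (f ⊠₁ 𝟙 Y) ◁ tMap (𝟙 (𝟙 X')) γ ≫ (interchangerator f g').hom =
      (interchangerator f g).hom ≫ tMap (𝟙 (𝟙 X)) γ ▷ (f ⊠₁ 𝟙 Y') :=
  (tensor (B := B)).mapSquare_naturality_right (a := (X, Y)) (a' := (X', Y)) (b := (X, Y'))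
    (b' := (X', Y')) (p := (f, 𝟙 Y)) (q := (𝟙 X', g)) (q₁ := (𝟙 X', g')) (q' := (𝟙 X, g))
    (q₁' := (𝟙 X, g')) (p' := (f, 𝟙 Y')) (Γ := Prod.mkHom (𝟙 (𝟙 X')) γ)
    (Γ' := Prod.mkHom (𝟙 (𝟙 X)) γ)
    (γ := Prod.mkHom ((ρ_ f).hom ≫ (λ_ f).inv) ((λ_ g).hom ≫ (ρ_ g).inv))
    (γ₁ := Prod.mkHom ((ρ_ f).hom ≫ (λ_ f).inv) ((λ_ g').hom ≫ (ρ_ g').inv))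
    (by
      refine Prod.ext ?_ ?_
      · change f ◁ 𝟙 (𝟙 X') ≫ (ρ_ f).hom ≫ (λ_ f).inv =
          ((ρ_ f).hom ≫ (λ_ f).inv) ≫ 𝟙 (𝟙 X) ▷ f
        bicategory
      · change 𝟙 Y ◁ γ ≫ (λ_ g').hom ≫ (ρ_ g').inv = ((λ_ g).hom ≫ (ρ_ g).inv) ≫ γ ▷ 𝟙 Y'
        bicategory)

theorem interchangerator_comp_right {X X' Y Y' Y'' : B} (f : X ⟶ X') (g : Y ⟶ Y') (h : Y' ⟶ Y'') :
    (interchangerator f (g ≫ h)).hom =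
      (f ⊠₁ 𝟙 Y) ◁ (lComp X' g h).hom ⊗≫ (interchangerator f g).hom ▷ (𝟙 X' ⊠₁ h) ⊗≫
        (𝟙 X ⊠₁ g) ◁ (interchangerator f h).hom ⊗≫ (lComp X g h).inv ▷ (f ⊠₁ 𝟙 Y'') := by
  have key : (interchangerator f (g ≫ h)).hom = (f ⊠₁ 𝟙 Y) ◁ (lComp X' g h).hom ≫
      (α_ _ _ _).inv ≫ (interchangerator f g).hom ▷ (𝟙 X' ⊠₁ h) ≫ (α_ _ _ _).hom ≫
      (𝟙 X ⊠₁ g) ◁ (interchangerator f h).hom ≫ (α_ _ _ _).inv ≫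
      (lComp X g h).inv ▷ (f ⊠₁ 𝟙 Y'') :=
    (tensor (B := B)).mapSquare_paste_right (a := (X, Y)) (a' := (X', Y)) (b := (X, Y'))
      (b' := (X', Y')) (c := (X, Y'')) (c' := (X', Y''))
      (p := (f, 𝟙 Y)) (q := (𝟙 X', g)) (q' := (𝟙 X, g)) (p' := (f, 𝟙 Y')) (s := (𝟙 X', h))
      (s' := (𝟙 X, h)) (p'' := (f, 𝟙 Y'')) (k := (𝟙 X', g ≫ h)) (k' := (𝟙 X, g ≫ h))
      (Iso.prod (λ_ (𝟙 X')).symm (Iso.refl (g ≫ h)))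
      (Iso.prod (λ_ (𝟙 X)).symm (Iso.refl (g ≫ h)))
      (γ := Prod.mkHom ((ρ_ f).hom ≫ (λ_ f).inv) ((λ_ g).hom ≫ (ρ_ g).inv))
      (δ := Prod.mkHom ((ρ_ f).hom ≫ (λ_ f).inv) ((λ_ h).hom ≫ (ρ_ h).inv))
      (κ := Prod.mkHom ((ρ_ f).hom ≫ (λ_ f).inv) ((λ_ (g ≫ h)).hom ≫ (ρ_ (g ≫ h)).inv))
      (by
        refine Prod.ext ?_ ?_
        · change (ρ_ f).hom ≫ (λ_ f).inv = f ◁ (λ_ (𝟙 X')).inv ≫ (α_ f (𝟙 X') (𝟙 X')).inv ≫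
            ((ρ_ f).hom ≫ (λ_ f).inv) ▷ 𝟙 X' ≫ (α_ (𝟙 X) f (𝟙 X')).hom ≫
            𝟙 X ◁ ((ρ_ f).hom ≫ (λ_ f).inv) ≫ (α_ (𝟙 X) (𝟙 X) f).inv ≫ (λ_ (𝟙 X)).hom ▷ f
          bicategory
        · change (λ_ (g ≫ h)).hom ≫ (ρ_ (g ≫ h)).inv = 𝟙 Y ◁ 𝟙 (g ≫ h) ≫ (α_ (𝟙 Y) g h).inv ≫
            ((λ_ g).hom ≫ (ρ_ g).inv) ▷ h ≫ (α_ g (𝟙 Y') h).hom ≫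
            g ◁ ((λ_ h).hom ≫ (ρ_ h).inv) ≫ (α_ g h (𝟙 Y'')).inv ≫ 𝟙 (g ≫ h) ▷ 𝟙 Y''
          bicategory)
  rw [key]; bicategory

theorem interchangerator_comp_left {X X' X'' Y Y' : B} (f : X ⟶ X') (g : X' ⟶ X'') (h : Y ⟶ Y') :
    (interchangerator (f ≫ g) h).hom =
      (rComp f g Y).hom ▷ (𝟙 X'' ⊠₁ h) ⊗≫ (f ⊠₁ 𝟙 Y) ◁ (interchangerator g h).hom ⊗≫
        (interchangerator f h).hom ▷ (g ⊠₁ 𝟙 Y') ⊗≫ (𝟙 X ⊠₁ h) ◁ (rComp f g Y').inv := by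
  have key : (interchangerator (f ≫ g) h).hom = (rComp f g Y).hom ▷ (𝟙 X'' ⊠₁ h) ≫
      (α_ _ _ _).hom ≫ (f ⊠₁ 𝟙 Y) ◁ (interchangerator g h).hom ≫ (α_ _ _ _).inv ≫
      (interchangerator f h).hom ▷ (g ⊠₁ 𝟙 Y') ≫ (α_ _ _ _).hom ≫
      (𝟙 X ⊠₁ h) ◁ (rComp f g Y').inv :=
    (tensor (B := B)).mapSquare_paste_left (a := (X, Y)) (b := (X', Y)) (c := (X'', Y))
      (a' := (X, Y')) (b' := (X', Y')) (c' := (X'', Y'))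
      (p := (f, 𝟙 Y)) (p₂ := (g, 𝟙 Y)) (k := (f ≫ g, 𝟙 Y)) (q := (𝟙 X'', h)) (q' := (𝟙 X', h))
      (q'' := (𝟙 X, h)) (p' := (f, 𝟙 Y')) (p₂' := (g, 𝟙 Y')) (k' := (f ≫ g, 𝟙 Y'))
      (Iso.prod (Iso.refl (f ≫ g)) (λ_ (𝟙 Y)).symm)
      (Iso.prod (Iso.refl (f ≫ g)) (λ_ (𝟙 Y')).symm)
      (γ := Prod.mkHom ((ρ_ f).hom ≫ (λ_ f).inv) ((λ_ h).hom ≫ (ρ_ h).inv))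
      (δ := Prod.mkHom ((ρ_ g).hom ≫ (λ_ g).inv) ((λ_ h).hom ≫ (ρ_ h).inv))
      (κ := Prod.mkHom ((ρ_ (f ≫ g)).hom ≫ (λ_ (f ≫ g)).inv) ((λ_ h).hom ≫ (ρ_ h).inv))
      (by
        refine Prod.ext ?_ ?_
        · change (ρ_ (f ≫ g)).hom ≫ (λ_ (f ≫ g)).inv = 𝟙 (f ≫ g) ▷ 𝟙 X'' ≫
            (α_ f g (𝟙 X'')).hom ≫ f ◁ ((ρ_ g).hom ≫ (λ_ g).inv) ≫ (α_ f (𝟙 X') g).inv ≫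
            ((ρ_ f).hom ≫ (λ_ f).inv) ▷ g ≫ (α_ (𝟙 X) f g).hom ≫ 𝟙 X ◁ 𝟙 (f ≫ g)
          bicategory
        · change (λ_ h).hom ≫ (ρ_ h).inv = (λ_ (𝟙 Y)).inv ▷ h ≫ (α_ (𝟙 Y) (𝟙 Y) h).hom ≫
            𝟙 Y ◁ ((λ_ h).hom ≫ (ρ_ h).inv) ≫ (α_ (𝟙 Y) h (𝟙 Y')).inv ≫
            ((λ_ h).hom ≫ (ρ_ h).inv) ▷ 𝟙 Y' ≫ (α_ h (𝟙 Y') (𝟙 Y')).hom ≫ h ◁ (λ_ (𝟙 Y')).hom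
          bicategory)
  rw [key]; bicategory

end Interchangerator

/-! ### The scalar braid as a conjugated slide -/

section ScalarBraid

variable {B : Type u} [Bicategory.{w, v} B] [MonoidalBicategory B]

/-- The naturality square of the left unitor at a scalar, carried over to the right unitor by `θ`. -/
def lSqθ (g : I B ⟶ I B) : (𝟙 (I B) ⊠₁ g) ≫ run (I B) ≅ run (I B) ≫ g :=
  whiskerLeftIso _ (θ B).symm ≪≫ lSq g ≪≫ whiskerRightIso (θ B) g

theorem lSqθ_naturality {g g' : I B ⟶ I B} (γ : g ⟶ g') :
    tMap (𝟙 (𝟙 (I B))) γ ▷ run (I B) ≫ (lSqθ g').hom = (lSqθ g).hom ≫ run (I B) ◁ γ := by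
  simp only [lSqθ, Iso.trans_hom, whiskerLeftIso_hom, whiskerRightIso_hom, Iso.symm_hom,
    Category.assoc]
  rw [← whisker_exchange, ← whisker_exchange_assoc, reassoc_of% (lSq_naturality γ)]

/-- Pasting the squares of `g` and `h` puts `θ` next to its inverse in the middle, leaving the
composite law for `lSq` conjugated by `θ`. -/
theorem lSqθ_comp (g h : I B ⟶ I B) :
    (lSqθ (g ≫ h)).hom = (lComp (I B) g h).hom ▷ run (I B) ⊗≫
      (𝟙 (I B) ⊠₁ g) ◁ (lSqθ h).hom ⊗≫ (lSqθ g).hom ▷ h ⊗≫ 𝟙 _ := by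
  simp only [lSqθ, Iso.trans_hom, whiskerLeftIso_hom, whiskerRightIso_hom, Iso.symm_hom]
  rw [lSq_comp]
  symm
  calc
    _ = (lComp (I B) g h).hom ▷ run (I B) ⊗≫ (𝟙 (I B) ⊠₁ g) ◁ (𝟙 (I B) ⊠₁ h) ◁ (θ B).inv ⊗≫
        (𝟙 (I B) ⊠₁ g) ◁ (lSq h).hom ⊗≫ (𝟙 (I B) ⊠₁ g) ◁ ((θ B).hom ≫ (θ B).inv) ▷ h ⊗≫
        (lSq g).hom ▷ h ⊗≫ (θ B).hom ▷ (g ≫ h) := by bicategory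
    _ = 𝟙 _ ⊗≫ ((lComp (I B) g h).hom ▷ run (I B) ≫
        ((𝟙 (I B) ⊠₁ g) ≫ (𝟙 (I B) ⊠₁ h)) ◁ (θ B).inv) ⊗≫
        (𝟙 (I B) ⊠₁ g) ◁ (lSq h).hom ⊗≫ (lSq g).hom ▷ h ⊗≫ (θ B).hom ▷ (g ≫ h) := by
      rw [Iso.hom_inv_id]; bicategory
    _ = _ := by rw [← whisker_exchange]; bicategory

/-- The bridge from the braid to slides: once the braid is recognised as a conjugate,
`whiskerLeft_conj` removes the cup and cap. -/
theorem whiskerLeft_scalarBraid (f g : I B ⟶ I B) :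
    run (I B) ◁ scalarBraid f g = slide (rSq f) (lSqθ g) (interchangerator f g).hom := by
  refine Eq.trans (congrArg (run (I B) ◁ ·) ?_) (whiskerLeft_conj (rightUnitorEquivalence (I B))
    (slide (rSq f) (lSqθ g) (interchangerator f g).hom))
  symm
  calc
    _ = 𝟙 _ ⊗≫ (rCounit (I B)).inv ▷ (f ≫ g) ⊗≫ rInv (I B) ◁ (rSq f).inv ▷ g ⊗≫
        (rInv (I B) ≫ (f ⊠₁ 𝟙 (I B))) ◁ (θ B).inv ▷ g ⊗≫
        (rInv (I B) ≫ (f ⊠₁ 𝟙 (I B))) ◁ (lSq g).inv ⊗≫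
        rInv (I B) ◁ (((f ⊠₁ 𝟙 (I B)) ≫ (𝟙 (I B) ⊠₁ g)) ◁ (θ B).hom ≫
          (interchangerator f g).hom ▷ run (I B)) ⊗≫
        (rInv (I B) ≫ (𝟙 (I B) ⊠₁ g)) ◁ (rSq f).hom ⊗≫
        (rInv (I B) ≫ (𝟙 (I B) ⊠₁ g)) ◁ (θ B).inv ▷ f ⊗≫
        rInv (I B) ◁ (lSq g).hom ▷ f ⊗≫ rInv (I B) ◁ (θ B).hom ▷ (g ≫ f) ⊗≫
        (rCounit (I B)).hom ▷ (g ≫ f) ⊗≫ 𝟙 _ := by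
      simp only [slide, lSqθ, rightUnitorEquivalence, Iso.trans_hom, Iso.trans_inv,
        whiskerLeftIso_hom, whiskerRightIso_hom, whiskerLeftIso_inv, whiskerRightIso_inv,
        Iso.symm_hom, Iso.symm_inv]
      bicategory
    -- The slide applies `θ` before `χ`, the braid after it; interchange identifies the two.
    _ = _ := by
      rw [whisker_exchange, scalarBraid]; bicategory

theorem whiskerLeft_run_inj {f g : I B ⟶ I B} {α β : f ⟶ g} :
    run (I B) ◁ α = run (I B) ◁ β ↔ α = β :=
  ⟨whiskerLeft_injective_of_rightInverse (rCounit (I B)), fun h => h ▸ rfl⟩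

instance isIso_scalarBraid (f g : I B ⟶ I B) : IsIso (scalarBraid f g) := by
  unfold scalarBraid bicategoricalComp
  infer_instance

theorem scalarBraid_naturality_left {f f' : I B ⟶ I B} (γ : f ⟶ f') (g : I B ⟶ I B) :
    γ ▷ g ≫ scalarBraid f' g = scalarBraid f g ≫ g ◁ γ := by
  rw [← whiskerLeft_run_inj, Bicategory.whiskerLeft_comp, Bicategory.whiskerLeft_comp,
    whiskerLeft_scalarBraid, whiskerLeft_scalarBraid]
  exact slide_naturality_left (rSq_naturality γ) (interchangerator_naturality_left γ g)

theorem scalarBraid_naturality_right (f : I B ⟶ I B) {g g' : I B ⟶ I B} (γ : g ⟶ g') :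
    f ◁ γ ≫ scalarBraid f g' = scalarBraid f g ≫ γ ▷ f := by
  rw [← whiskerLeft_run_inj, Bicategory.whiskerLeft_comp, Bicategory.whiskerLeft_comp,
    whiskerLeft_scalarBraid, whiskerLeft_scalarBraid]
  exact slide_naturality_right (lSqθ_naturality γ) (interchangerator_naturality_right f γ)

theorem scalarBraid_comp_right (f g h : I B ⟶ I B) :
    scalarBraid f (g ≫ h) = 𝟙 _ ⊗≫ scalarBraid f g ▷ h ⊗≫ g ◁ scalarBraid f h ⊗≫ 𝟙 _ := by
  rw [← whiskerLeft_run_inj, whiskerLeft_scalarBraid,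
    slide_comp_right (lComp (I B) g h) (lSqθ_comp g h) (interchangerator_comp_right f g h)
      (whiskerLeft_scalarBraid f h), ← whiskerLeft_scalarBraid]
  bicategory

theorem scalarBraid_comp_left (f g h : I B ⟶ I B) :
    scalarBraid (f ≫ g) h = 𝟙 _ ⊗≫ f ◁ scalarBraid g h ⊗≫ scalarBraid f h ▷ g ⊗≫ 𝟙 _ := by
  rw [← whiskerLeft_run_inj, whiskerLeft_scalarBraid,
    slide_comp_left (rComp f g (I B)) (rSq_comp f g) (interchangerator_comp_left f g h)
      (whiskerLeft_scalarBraid g h), ← whiskerLeft_scalarBraid]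
  bicategory

variable (B) in
/-- The braiding on the scalars of a monoidal bicategory. -/
noncomputable abbrev scalarBraidedCategory : BraidedCategory (EndMonoidal (I B)) where
  braiding f g := asIso (scalarBraid f g)
  braiding_naturality_right f _ _ γ := scalarBraid_naturality_right f γ
  braiding_naturality_left γ g := scalarBraid_naturality_left γ g
  hexagon_forward f g h := by
    change (α_ f g h).hom ≫ scalarBraid f (g ≫ h) ≫ (α_ g h f).hom =
      scalarBraid f g ▷ h ≫ (α_ g f h).hom ≫ g ◁ scalarBraid f h
    rw [scalarBraid_comp_right]; bicategory
  hexagon_reverse f g h := by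
    change (α_ f g h).inv ≫ scalarBraid (f ≫ g) h ≫ (α_ h f g).inv =
      f ◁ scalarBraid g h ≫ (α_ f h g).inv ≫ scalarBraid f h ▷ g
    rw [scalarBraid_comp_left]; bicategory

end ScalarBraid

end CategoryTheory.MonoidalBicategory

theorem mainTheorem5 {B : Type u} [Bicategory.{w, v} B] [MonoidalBicategory B] :
    (∃ b : BraidedCategory (EndMonoidal (TensorBicategory.I B)),
      ∀ f g : EndMonoidal (TensorBicategory.I B),
        (b.braiding f g).hom = MonoidalBicategory.scalarBraid f g) ∧
    (∃ b : BraidedCategory (EndMonoidal (TensorBicategory.I B))ᴹᵒᵖ,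
      ∀ f g : EndMonoidal (TensorBicategory.I B),
        (b.braiding ⟨g⟩ ⟨f⟩).hom.unmop = MonoidalBicategory.scalarBraid f g) := by
  let b := MonoidalBicategory.scalarBraidedCategory B
  -- In `EndMonoidal` the tensor product is `f ≫ g`; its monoidal opposite has `f ∘ g`, and the
  -- induced braiding there swaps the two arguments.
  exact ⟨⟨b, fun _ _ => rfl⟩, ⟨MonoidalOpposite.instBraiding, fun _ _ => rfl⟩⟩
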